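/- Throughout, all Hilbert spaces are finite-dimensional, $\log$ is to base $2$, $\delta(\rho,\sigma)=\tfrac12\|\rho-\sigma\|_1$ is the trace distance (with $\|S\|_1=\operatorname{tr}\sqrt{S^\dagger S}$), and $\omega_m$ is the maximally mixed state on $m$ bits. A cq-state on $X C$ is a density operator of the form $\rho_{XC}=\sum_x |x\rangle\langle x|\otimes\rho_{C\wedge x}$; it is called classical if it is in addition diagonal in the preferred basis of $C$, i.e. $\rho_{XC}=\sum_{x,c}P(x,c)\,|x\rangle\langle x|\otimes|c\rangle\langle c|$. The conditional min-entropy is $$H_{\min}(X|C)_\rho=\sup_{\sigma_C}\ \sup\{z\in\mathbb R:\ \rho_{XC}\le 2^{-z}\,\mathbb 1_X\otimes\sigma_C\},$$ where $\sigma_C$ ranges over all density operators on $C$ (and the supremum over the empty set is $-\infty$). Let $n_1,n_2,m$ be natural numbers and $k_1,k_2,\varepsilon$ be real numbers. A function $\mathrm{Ext}:\{0,1\}^{n_1}\times\{0,1\}^{n_2}\to\{0,1\}^m$ is called a $(k_1,k_2,\varepsilon)$ weak two-source extractor against quantum (respectively classical) product-type knowledge if, for every pair of cq-states (respectively classical states)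 $\rho_{X_1C_1}$, $\rho_{X_2C_2}$ with $X_i$ taking values in $\{0,1\}^{n_i}$ and with $H_{\min}(X_1|C_1)\ge k_1$ and $H_{\min}(X_2|C_2)\ge k_2$, the product state $\rho_{X_1X_2C}=\rho_{X_1C_1}\otimes\rho_{X_2C_2}$ with $C=C_1C_2$ satisfies $$\delta\bigl(\rho_{\mathrm{Ext}(X_1,X_2)C},\ \omega_m\otimes\rho_C\bigr)\le\varepsilon .$$ **Lemma.** Every $(k_1,k_2,\varepsilon)$ weak two-source extractor $\mathrm{Ext}:\{0,1\}^{n_1}\times\{0,1\}^{n_2}\to\{0,1\}^m$ against classical product-type knowledge is a $(k_1,k_2,\sqrt{2^{m-1}\varepsilon})$ weak two-source extractor against quantum product-type knowledge. -/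

import Mathlib

namespace TwoSource

open scoped MatrixOrder Kronecker ComplexOrder

noncomputable section

/-- Bit strings of length `n`, i.e. `{0,1}^n`. -/
abbrev Bits (n : ℕ) : Type := Fin n → Bool

/-- Density operators on the finite-dimensional Hilbert space with orthonormal basis `A`:
positive semidefinite matrices of trace one. -/
structure IsDensity {A : Type*} [Fintype A] (ρ : Matrix A A ℂ) : Prop where
  posSemidef : ρ.PosSemidef
  trace_eq_one : ρ.trace = 1

/-- The trace norm `‖S‖₁ = tr √(S† S)`. -/
def traceNorm {A : Type*} [Fintype A] [DecidableEq A] (S : Matrix A A ℂ) : ℝ :=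
  (CFC.sqrt (S.conjTranspose * S)).trace.re

/-- The trace distance `δ(ρ, σ) = ½ ‖ρ - σ‖₁`. -/
def traceDist {A : Type*} [Fintype A] [DecidableEq A] (ρ σ : Matrix A A ℂ) : ℝ :=
  1 / 2 * traceNorm (ρ - σ)

/-- The maximally mixed state on the space with orthonormal basis `A`. -/
def maxMixed (A : Type*) [Fintype A] [DecidableEq A] : Matrix A A ℂ :=
  (1 / (Fintype.card A : ℂ)) • (1 : Matrix A A ℂ)

/-- The min-entropy of `ρ_{AB}` relative to `σ_B`: the largest `z` with
`ρ_{AB} ≤ 2^{-z} · 1_A ⊗ σ_B` in the Loewner order. The value is `-∞` if there is no such `z`,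
which for positive semidefinite `ρ_{AB}` and `σ_B` happens exactly when the kernel of `1_A ⊗ σ_B`
is not contained in that of `ρ_{AB}`. -/
def relMinEntropy {A B : Type*} [Fintype A] [DecidableEq A] [Fintype B] [DecidableEq B]
    (ρ : Matrix (A × B) (A × B) ℂ) (σ : Matrix B B ℂ) : EReal :=
  sSup ((fun z : ℝ => (z : EReal)) ''
    {z : ℝ | ρ ≤ ((2 : ℝ) ^ (-z)) • ((1 : Matrix A A ℂ) ⊗ₖ σ)})

/-- The conditional min-entropy `H_min(A|B)_ρ`: the relative min-entropy, optimized over all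
density operators `σ_B`. -/
def minEntropy {A B : Type*} [Fintype A] [DecidableEq A] [Fintype B] [DecidableEq B]
    (ρ : Matrix (A × B) (A × B) ℂ) : EReal :=
  sSup (relMinEntropy ρ '' {σ : Matrix B B ℂ | IsDensity σ})

/-- `ρ_{XC}` is classical on `X`, i.e. of the form `∑ x, |x⟩⟨x| ⊗ ρ_{C∧x}`: all blocks off the
diagonal in the preferred basis of `X` vanish. -/
def IsCQ {X C : Type*} (ρ : Matrix (X × C) (X × C) ℂ) : Prop :=
  ∀ x x' c c', x ≠ x' → ρ (x, c) (x', c') = 0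

/-- `ρ_{XC}` is classical on both `X` and `C`, i.e. of the form
`∑ x c, P(x, c) |x⟩⟨x| ⊗ |c⟩⟨c|`. -/
def IsClassical {X C : Type*} (ρ : Matrix (X × C) (X × C) ℂ) : Prop :=
  ρ.IsDiag

/-- The product state `ρ_{X₁X₂C₁C₂} = ρ_{X₁C₁} ⊗ ρ_{X₂C₂}`, with the tensor factors sorted so that
the sources `X₁X₂` come first and the side information `C = C₁C₂` second. -/
def productState {X₁ X₂ C₁ C₂ : Type*}
    (ρ₁ : Matrix (X₁ × C₁) (X₁ × C₁) ℂ) (ρ₂ : Matrix (X₂ × C₂) (X₂ × C₂) ℂ) :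
    Matrix ((X₁ × X₂) × (C₁ × C₂)) ((X₁ × X₂) × (C₁ × C₂)) ℂ :=
  Matrix.reindex (Equiv.prodProdProdComm X₁ C₁ X₂ C₂) (Equiv.prodProdProdComm X₁ C₁ X₂ C₂)
    (ρ₁ ⊗ₖ ρ₂)

/-- The state `ρ_{f(X)C} = ∑ x, |f(x)⟩⟨f(x)| ⊗ ⟨x| ρ_{XC} |x⟩`, obtained by applying the classical
function `f` to the register `X` and the identity channel to `C`. -/
def applyFun {X Y C : Type*} [Fintype X] [DecidableEq Y] (f : X → Y)
    (ρ : Matrix (X × C) (X × C) ℂ) : Matrix (Y × C) (Y × C) ℂ :=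
  ∑ x, Matrix.single (f x) (f x) (1 : ℂ) ⊗ₖ Matrix.of fun c c' => ρ (x, c) (x, c')

/-- The reduced state `ρ_C = tr_X ρ_{XC}`. -/
def reduced {X C : Type*} [Fintype X] (ρ : Matrix (X × C) (X × C) ℂ) : Matrix C C ℂ :=
  Matrix.of fun c c' => ∑ x, ρ (x, c) (x, c')

/-- The distance `δ(ρ_{Ext(X₁,X₂)C}, ω_m ⊗ ρ_C)` for `ρ_{X₁X₂C} = ρ_{X₁C₁} ⊗ ρ_{X₂C₂}`. -/
def weakError {n₁ n₂ m : ℕ} (Ext : Bits n₁ → Bits n₂ → Bits m)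
    {C₁ C₂ : Type*} [Fintype C₁] [DecidableEq C₁] [Fintype C₂] [DecidableEq C₂]
    (ρ₁ : Matrix (Bits n₁ × C₁) (Bits n₁ × C₁) ℂ)
    (ρ₂ : Matrix (Bits n₂ × C₂) (Bits n₂ × C₂) ℂ) : ℝ :=
  traceDist (applyFun (fun x : Bits n₁ × Bits n₂ => Ext x.1 x.2) (productState ρ₁ ρ₂))
    (maxMixed (Bits m) ⊗ₖ reduced (productState ρ₁ ρ₂))

/-- `Ext` is a `(k₁, k₂, ε)` weak two-source extractor against classical product-type knowledge. -/
def IsWeakExtractorClassical {n₁ n₂ m : ℕ} (k₁ k₂ ε : ℝ)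
    (Ext : Bits n₁ → Bits n₂ → Bits m) : Prop :=
  ∀ (C₁ C₂ : Type) [Fintype C₁] [DecidableEq C₁] [Fintype C₂] [DecidableEq C₂]
    (ρ₁ : Matrix (Bits n₁ × C₁) (Bits n₁ × C₁) ℂ)
    (ρ₂ : Matrix (Bits n₂ × C₂) (Bits n₂ × C₂) ℂ),
    IsDensity ρ₁ → IsDensity ρ₂ → IsClassical ρ₁ → IsClassical ρ₂ →
    (k₁ : EReal) ≤ minEntropy ρ₁ → (k₂ : EReal) ≤ minEntropy ρ₂ →
    weakError Ext ρ₁ ρ₂ ≤ ε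

/-- `Ext` is a `(k₁, k₂, ε)` weak two-source extractor against quantum product-type knowledge. -/
def IsWeakExtractorQuantum {n₁ n₂ m : ℕ} (k₁ k₂ ε : ℝ)
    (Ext : Bits n₁ → Bits n₂ → Bits m) : Prop :=
  ∀ (C₁ C₂ : Type) [Fintype C₁] [DecidableEq C₁] [Fintype C₂] [DecidableEq C₂]
    (ρ₁ : Matrix (Bits n₁ × C₁) (Bits n₁ × C₁) ℂ)
    (ρ₂ : Matrix (Bits n₂ × C₂) (Bits n₂ × C₂) ℂ),
    IsDensity ρ₁ → IsDensity ρ₂ → IsCQ ρ₁ → IsCQ ρ₂ →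
    (k₁ : EReal) ≤ minEntropy ρ₁ → (k₂ : EReal) ≤ minEntropy ρ₂ →
    weakError Ext ρ₁ ρ₂ ≤ ε

end

end TwoSource

namespace TwoSource

open scoped MatrixOrder Kronecker ComplexOrder

noncomputable section

set_option linter.unusedSectionVars false

/-! ### Spectral tools and a weighted Cauchy-Schwarz inequality -/

section Matrices

variable {A : Type*} [Fintype A] [DecidableEq A]

/-! The quantum error is bounded by a classical one in which each side system has undergone the
pretty good measurement of its source. Let `M` be the difference of the real and ideal states.
Cauchy-Schwarz with weight `ρ_C^{1/2}` (`traceNorm_sq_le`) gives `‖M‖₁² ≤ 2^m · tr (M R M R)`, where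
`R` is `ρ_C^{-1/2}` on the support of `ρ_C`, tensored with the identity on the output.

Expanding the last trace yields terms `tr (ρ_x R ρ_y R)`, which are the joint probabilities of
source value `x` and guess `y`, and they factor over the two sources. The trace is thus the
advantage of the classical test "is the output `Ext` of the guesses?", so it is at most the
classical error.

Measuring the side information does not lower min-entropy (`minEntropy_le_measuredState`), so that
error is at most `ε`. -/

theorem exists_spectral_decomposition {M : Matrix A A ℂ} (hM : M.IsHermitian) :
    ∃ U : Matrix A A ℂ, U.conjTranspose * U = 1 ∧ U * U.conjTranspose = 1 ∧
      M = U * Matrix.diagonal (fun i => (hM.eigenvalues i : ℂ)) * U.conjTranspose := by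
  refine ⟨hM.eigenvectorUnitary, ?_, ?_, ?_⟩
  · exact (Matrix.mem_unitaryGroup_iff').1 hM.eigenvectorUnitary.2
  · exact (Matrix.mem_unitaryGroup_iff).1 hM.eigenvectorUnitary.2
  · exact hM.spectral_theorem

theorem conj_diagonal_mul {U : Matrix A A ℂ} (hU : U.conjTranspose * U = 1) (f g : A → ℂ) :
    (U * Matrix.diagonal f * U.conjTranspose) * (U * Matrix.diagonal g * U.conjTranspose) =
      U * Matrix.diagonal (fun i => f i * g i) * U.conjTranspose := by
  calc _ = U * Matrix.diagonal f * (U.conjTranspose * U) * Matrix.diagonal g *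
        U.conjTranspose := by simp only [Matrix.mul_assoc]
    _ = _ := by
      rw [hU, Matrix.mul_one, Matrix.mul_assoc U, Matrix.diagonal_mul_diagonal]

theorem isHermitian_conj_diagonal (U : Matrix A A ℂ) (f : A → ℝ) :
    (U * Matrix.diagonal (fun i => (f i : ℂ)) * U.conjTranspose).IsHermitian := by
  refine Matrix.isHermitian_mul_mul_conjTranspose U ?_
  exact Matrix.isHermitian_diagonal_of_self_adjoint _ (by ext i; simp)

theorem posSemidef_conj_diagonal (U : Matrix A A ℂ) {f : A → ℝ} (hf : ∀ i, 0 ≤ f i) :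
    (U * Matrix.diagonal (fun i => (f i : ℂ)) * U.conjTranspose).PosSemidef :=
  (Matrix.PosSemidef.diagonal fun i => by simpa using hf i).mul_mul_conjTranspose_same U

/-- A Hermitian matrix has a self-adjoint unitary sign, which attains its trace norm. -/
theorem exists_sign {M : Matrix A A ℂ} (hM : M.IsHermitian) :
    ∃ W : Matrix A A ℂ, W.IsHermitian ∧ W * W = 1 ∧ (W * M).trace = (traceNorm M : ℂ) := by
  obtain ⟨U, hU, hU', hdec⟩ := exists_spectral_decomposition hM
  set l := hM.eigenvalues
  let s : A → ℝ := fun i => if 0 ≤ l i then 1 else -1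
  have hs : ∀ i, s i * s i = 1 := fun i => by simp only [s]; split_ifs <;> norm_num
  have hsl : ∀ i, s i * l i = |l i| := fun i => by
    simp only [s]
    split_ifs with h
    · rw [abs_of_nonneg h, one_mul]
    · rw [abs_of_neg (not_le.1 h), neg_one_mul]
  have habs : (U * Matrix.diagonal (fun i => ((|l i| : ℝ) : ℂ)) * U.conjTranspose).PosSemidef :=
    posSemidef_conj_diagonal U fun i => abs_nonneg _
  have hsqrt : CFC.sqrt (M.conjTranspose * M) =
      U * Matrix.diagonal (fun i => ((|l i| : ℝ) : ℂ)) * U.conjTranspose := by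
    refine CFC.sqrt_unique ?_ habs.nonneg
    rw [hM.eq, conj_diagonal_mul hU]
    conv_rhs => rw [hdec, conj_diagonal_mul hU]
    simp only [← Complex.ofReal_mul, abs_mul_abs_self]
  refine ⟨U * Matrix.diagonal (fun i => (s i : ℂ)) * U.conjTranspose,
    isHermitian_conj_diagonal U s, ?_, ?_⟩
  · rw [conj_diagonal_mul hU]
    simp only [← Complex.ofReal_mul, hs, Complex.ofReal_one, Matrix.diagonal_one, Matrix.mul_one,
      hU']
  · rw [traceNorm, hsqrt]
    conv_lhs => rw [hdec, conj_diagonal_mul hU]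
    simp only [← Complex.ofReal_mul, hsl]
    have h := Complex.nonneg_iff.1 habs.trace_nonneg
    exact Complex.ext rfl h.2.symm

theorem traceNorm_diagonal (d : A → ℝ) :
    traceNorm (Matrix.diagonal fun i => (d i : ℂ)) = ∑ i, |d i| := by
  have h : CFC.sqrt ((Matrix.diagonal fun i => (d i : ℂ)).conjTranspose *
      Matrix.diagonal fun i => (d i : ℂ)) = Matrix.diagonal fun i => ((|d i| : ℝ) : ℂ) := by
    refine CFC.sqrt_unique ?_ (Matrix.PosSemidef.diagonal fun i => by simp).nonneg
    simp [Matrix.diagonal_conjTranspose, Matrix.diagonal_mul_diagonal, ← Complex.ofReal_mul]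
  rw [traceNorm, h, Matrix.trace_diagonal, ← Complex.ofReal_sum, Complex.ofReal_re]

theorem trace_mul_nonneg {S T : Matrix A A ℂ} (hS : S.PosSemidef) (hT : T.PosSemidef) :
    0 ≤ (S * T).trace := by
  obtain ⟨B, rfl⟩ := CStarAlgebra.nonneg_iff_eq_star_mul_self.1 hT.nonneg
  rw [Matrix.star_eq_conjTranspose, ← Matrix.mul_assoc, Matrix.trace_mul_comm, ← Matrix.mul_assoc]
  exact (hS.mul_mul_conjTranspose_same B).trace_nonneg

theorem mul_eq_zero_of_conj_eq_zero {S X : Matrix A A ℂ} (hS : S.PosSemidef)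
    (h : X.conjTranspose * S * X = 0) : S * X = 0 := by
  obtain ⟨B, rfl⟩ := CStarAlgebra.nonneg_iff_eq_star_mul_self.1 hS.nonneg
  rw [Matrix.star_eq_conjTranspose] at h ⊢
  have : (B * X).conjTranspose * (B * X) = 0 := by
    rw [← h, Matrix.conjTranspose_mul]; simp only [Matrix.mul_assoc]
  rw [Matrix.mul_assoc, Matrix.conjTranspose_mul_self_eq_zero.1 this, Matrix.mul_zero]

/-- Sandwiching `0 ≤ S ≤ T` between `Xᴴ` and `X` squeezes `Xᴴ S X` to zero: the kernel of `T` lies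
in that of `S`. -/
theorem mul_eq_zero_of_le {S T X : Matrix A A ℂ} (hS : S.PosSemidef) (hST : S ≤ T)
    (h : T * X = 0) : S * X = 0 := by
  refine mul_eq_zero_of_conj_eq_zero hS (le_antisymm ?_ ?_)
  · have := (Matrix.PosSemidef.conjTranspose_mul_mul_same (Matrix.le_iff.1 hST) X)
    rw [Matrix.mul_sub, Matrix.sub_mul, Matrix.mul_assoc _ T, h, Matrix.mul_zero] at this
    exact Matrix.le_iff.2 this
  · exact (hS.conjTranspose_mul_mul_same X).nonneg

/-- `Q` is a square root of `S`, and `R` is the Moore-Penrose inverse of `Q`. -/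
structure IsSqrtPinv (S Q R : Matrix A A ℂ) : Prop where
  posSemidef_left : Q.PosSemidef
  isHermitian_right : R.IsHermitian
  mul_self : Q * Q = S
  mul_mul : S * (R * Q) = S
  conj : R * S * R = R * Q
  posSemidef_one_sub : (1 - R * Q).PosSemidef

theorem exists_isSqrtPinv {S : Matrix A A ℂ} (hS : S.PosSemidef) : ∃ Q R, IsSqrtPinv S Q R := by
  obtain ⟨U, hU, hU', hdec⟩ := exists_spectral_decomposition hS.isHermitian
  have hl := hS.eigenvalues_nonneg
  set l := hS.isHermitian.eigenvalues
  have hq : ∀ i, √(l i) * √(l i) = l i := fun i => Real.mul_self_sqrt (hl i)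
  -- Since `0⁻¹ = 0`, inverting entrywise gives the Moore-Penrose inverse.
  have hinv : ∀ i, (√(l i))⁻¹ * l i * (√(l i))⁻¹ = (√(l i))⁻¹ * √(l i) := fun i => by
    have h := hq i
    set r := √(l i)
    rw [← h]
    rcases eq_or_ne r 0 with h0 | h0
    · simp [h0]
    · field_simp
  refine ⟨U * Matrix.diagonal (fun i => (√(l i) : ℂ)) * U.conjTranspose,
    U * Matrix.diagonal (fun i => (((√(l i))⁻¹ : ℝ) : ℂ)) * U.conjTranspose,
    posSemidef_conj_diagonal U fun i => Real.sqrt_nonneg _, isHermitian_conj_diagonal U _,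
    ?_, ?_, ?_, ?_⟩
  · conv_rhs => rw [hdec]
    rw [conj_diagonal_mul hU]
    simp only [← Complex.ofReal_mul, hq]
  · conv_rhs => rw [hdec]
    conv_lhs => rw [hdec]
    simp only [conj_diagonal_mul hU, ← Complex.ofReal_mul]
    congr 3
    ext i
    rcases eq_or_ne (√(l i)) 0 with h | h
    · have := hq i
      simp [h] at this
      simp [← this]
    · rw [inv_mul_cancel₀ h, mul_one]
  · conv_lhs => rw [hdec]
    simp only [conj_diagonal_mul hU, ← Complex.ofReal_mul]
    congr 3
    ext i
    rw [hinv i]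
  · have h1 : (1 : Matrix A A ℂ) =
        U * Matrix.diagonal (fun i => ((1 : ℝ) : ℂ)) * U.conjTranspose := by simp [hU']
    conv => enter [1, 1]; rw [h1]
    rw [conj_diagonal_mul hU, ← Matrix.sub_mul, ← Matrix.mul_sub, Matrix.diagonal_sub]
    simp only [← Complex.ofReal_mul, ← Complex.ofReal_sub]
    refine posSemidef_conj_diagonal U fun i => ?_
    rcases eq_or_ne (√(l i)) 0 with h | h
    · simp [h]
    · simp [inv_mul_cancel₀ h]

/-- The Cauchy-Schwarz bound on the trace norm, with weight `Q` and inverse weight `R`. -/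
theorem traceNorm_sq_le {M Q R : Matrix A A ℂ} (hM : M.IsHermitian) (hQ : Q.PosSemidef)
    (hR : R.IsHermitian) (hMRQ : M * (R * Q) = M) :
    traceNorm M ^ 2 ≤ (Q * Q).trace.re * (M * R * (M * R)).trace.re := by
  obtain ⟨W, hW, hWW, hWM⟩ := exists_sign hM
  have hQRM : Q * R * M = M := by
    have := congrArg Matrix.conjTranspose hMRQ
    simpa [Matrix.conjTranspose_mul, hM.eq, hR.eq, hQ.isHermitian.eq] using this
  have hN : (R * M * R).IsHermitian := by
    have := Matrix.isHermitian_mul_mul_conjTranspose R hM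
    rwa [hR.eq] at this
  -- The gap is half the squared Hilbert-Schmidt norm of the commutator of `W` and `Q`.
  have hWQ : (W * Q * (W * Q)).trace.re ≤ (Q * Q).trace.re := by
    have h := (Matrix.posSemidef_conjTranspose_mul_self (W * Q - Q * W)).trace_nonneg
    have e : (W * Q - Q * W).conjTranspose * (W * Q - Q * W) =
        Q * (W * W) * Q - Q * W * (Q * W) - W * Q * (W * Q) + W * (Q * Q * W) := by
      rw [Matrix.conjTranspose_sub, Matrix.conjTranspose_mul, Matrix.conjTranspose_mul, hW.eq,
        hQ.isHermitian.eq]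
      noncomm_ring
    rw [e, hWW, Matrix.trace_add, Matrix.trace_sub, Matrix.trace_sub, Matrix.trace_mul_comm W,
      Matrix.mul_assoc _ W W, hWW, Matrix.mul_one, Matrix.mul_one,
      show (Q * W * (Q * W)).trace = (W * Q * (W * Q)).trace by
        rw [Matrix.mul_assoc, Matrix.trace_mul_comm]; simp only [Matrix.mul_assoc]] at h
    have := (Complex.nonneg_iff.1 h).1
    simp only [Complex.add_re, Complex.sub_re] at this
    linarith
  have e2 : (R * (M * (R * M))).trace = (M * R * (M * R)).trace := by
    rw [Matrix.trace_mul_comm]; simp only [Matrix.mul_assoc]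
  -- The quadratic is `tr (Z Q Z Q)` with `Z = W - t R M R`; its discriminant gives Cauchy-Schwarz.
  have key : ∀ t : ℝ, 0 ≤ (M * R * (M * R)).trace.re * (t * t) + (-2 * traceNorm M) * t +
      (W * Q * (W * Q)).trace.re := by
    intro t
    have hX : (W - (t : ℂ) • (R * M * R)).IsHermitian := by
      refine hW.sub ?_
      rw [Matrix.IsHermitian, Matrix.conjTranspose_smul, hN.eq]
      simp
    have h := trace_mul_nonneg
      (hQ.conjTranspose_mul_mul_same (W - (t : ℂ) • (R * M * R))) hQ
    rw [hX.eq] at h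
    have e : (W - (t : ℂ) • (R * M * R)) * Q * (W - (t : ℂ) • (R * M * R)) * Q =
        W * Q * (W * Q) - (t : ℂ) • (W * ((Q * R * M) * (R * Q)))
          - (t : ℂ) • (R * ((M * (R * Q)) * W * Q))
          + ((t : ℂ) * t) • (R * ((M * (R * Q)) * (R * (M * (R * Q))))) := by
      simp only [Matrix.sub_mul, Matrix.mul_sub, Matrix.smul_mul, Matrix.mul_smul, smul_smul,
        Matrix.mul_assoc, smul_sub]
      abel
    rw [e, hQRM, hMRQ] at h
    simp only [Matrix.trace_add, Matrix.trace_sub, Matrix.trace_smul] at h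
    have e1 : (R * (M * W * Q)).trace = (W * M).trace := by
      rw [← Matrix.mul_assoc, Matrix.trace_mul_comm,
        show Q * (R * (M * W)) = Q * R * M * W by simp only [Matrix.mul_assoc],
        hQRM, Matrix.trace_mul_comm]
    rw [e1, e2, hWM] at h
    have := (Complex.nonneg_iff.1 h).1
    simp only [Complex.add_re, Complex.sub_re, smul_eq_mul, ← Complex.ofReal_mul,
      Complex.re_ofReal_mul, Complex.ofReal_re] at this
    linarith
  have ha : 0 ≤ (M * R * (M * R)).trace.re := by
    have h := trace_mul_nonneg (hQ.conjTranspose_mul_mul_same (R * M * R)) hQ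
    rw [hN.eq, show R * M * R * Q * (R * M * R) * Q =
      R * ((M * (R * Q)) * (R * (M * (R * Q)))) by simp only [Matrix.mul_assoc], hMRQ, e2] at h
    exact (Complex.nonneg_iff.1 h).1
  have hd := discrim_le_zero key
  rw [discrim] at hd
  nlinarith [mul_le_mul_of_nonneg_right hWQ ha]

end Matrices

/-! ### Conditional operators of a state -/

/-- The subnormalized conditional operator `ρ_{C∧x}`. -/
def block {X C : Type*} (ρ : Matrix (X × C) (X × C) ℂ) (x : X) : Matrix C C ℂ :=
  Matrix.of fun c c' => ρ (x, c) (x, c')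

section Blocks

variable {X C : Type*} {ρ : Matrix (X × C) (X × C) ℂ}

theorem block_posSemidef (hρ : ρ.PosSemidef) (x : X) : (block ρ x).PosSemidef :=
  hρ.submatrix fun c => (x, c)

theorem block_diagonal [DecidableEq X] [DecidableEq C] (d : X × C → ℂ) (x : X) :
    block (Matrix.diagonal d) x = Matrix.diagonal fun c => d (x, c) := by
  ext c c'
  simp [block, Matrix.diagonal_apply]

theorem block_le [Fintype X] [DecidableEq X] [Fintype C] [DecidableEq C] {c : ℝ}
    {σ : Matrix C C ℂ} (h : ρ ≤ c • ((1 : Matrix X X ℂ) ⊗ₖ σ)) (x : X) :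
    block ρ x ≤ c • σ := by
  have h' := (Matrix.le_iff.1 h).submatrix fun c => (x, c)
  refine Matrix.le_iff.2 ?_
  convert h' using 1
  ext i j
  simp [block]

variable [Fintype X]

theorem reduced_eq_sum_block : reduced ρ = ∑ x, block ρ x := by
  ext c c'
  simp [reduced, block, Matrix.sum_apply]

theorem reduced_posSemidef (hρ : ρ.PosSemidef) : (reduced ρ).PosSemidef := by
  rw [reduced_eq_sum_block]
  exact Matrix.posSemidef_sum _ fun x _ => block_posSemidef hρ x

theorem trace_reduced [Fintype C] : (reduced ρ).trace = ρ.trace := by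
  simp only [Matrix.trace, reduced, Matrix.diag_apply, Matrix.of_apply, Fintype.sum_prod_type]
  exact Finset.sum_comm

theorem block_le_reduced [Fintype C] (hρ : ρ.PosSemidef) (x : X) : block ρ x ≤ reduced ρ := by
  rw [reduced_eq_sum_block]
  exact Finset.single_le_sum (f := fun x => block ρ x)
    (fun x _ => (block_posSemidef hρ x).nonneg) (Finset.mem_univ x)

/-- Each block is dominated by `reduced ρ`, so the support projection `R * Q` fixes it. -/
theorem block_mul_proj [Fintype C] [DecidableEq C] (hρ : ρ.PosSemidef) {Q R : Matrix C C ℂ}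
    (h : IsSqrtPinv (reduced ρ) Q R) (x : X) : block ρ x * (R * Q) = block ρ x := by
  have := mul_eq_zero_of_le (X := 1 - R * Q) (block_posSemidef hρ x) (block_le_reduced hρ x)
    (by rw [Matrix.mul_sub, Matrix.mul_one, h.mul_mul, sub_self])
  rw [Matrix.mul_sub, Matrix.mul_one, sub_eq_zero] at this
  exact this.symm

end Blocks

theorem block_productState {X₁ X₂ C₁ C₂ : Type*} (ρ₁ : Matrix (X₁ × C₁) (X₁ × C₁) ℂ)
    (ρ₂ : Matrix (X₂ × C₂) (X₂ × C₂) ℂ) (x : X₁ × X₂) :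
    block (productState ρ₁ ρ₂) x = block ρ₁ x.1 ⊗ₖ block ρ₂ x.2 := by
  ext c c'
  simp [block, productState]

/-! ### Pretty good measurement of the side information -/

section Measurement

variable {X C : Type*} [Fintype X] [DecidableEq X] [Fintype C] [DecidableEq C]
  {ρ : Matrix (X × C) (X × C) ℂ} {Q R : Matrix C C ℂ}

/-- The joint distribution of the source and the outcome of the measurement of the side
information with operators `R ρ_{C∧y} R`. -/
def measuredProb (ρ : Matrix (X × C) (X × C) ℂ) (R : Matrix C C ℂ) (x y : X) : ℝ :=
  (block ρ x * R * (block ρ y * R)).trace.re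

theorem conj_block_posSemidef (hρ : ρ.PosSemidef) (hR : R.IsHermitian) (y : X) :
    (R * block ρ y * R).PosSemidef := by
  have := (block_posSemidef hρ y).conjTranspose_mul_mul_same R
  rwa [hR.eq] at this

theorem trace_mul_conj_block_nonneg {S : Matrix C C ℂ} (hS : S.PosSemidef) (hρ : ρ.PosSemidef)
    (hR : R.IsHermitian) (y : X) : 0 ≤ (S * R * (block ρ y * R)).trace := by
  have := trace_mul_nonneg hS (conj_block_posSemidef hρ hR y)
  simpa only [Matrix.mul_assoc] using this

theorem measuredProb_nonneg (hρ : ρ.PosSemidef) (hR : R.IsHermitian) (x y : X) :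
    0 ≤ measuredProb ρ R x y :=
  (Complex.nonneg_iff.1 (trace_mul_conj_block_nonneg (block_posSemidef hρ x) hρ hR y)).1

theorem ofReal_measuredProb (hρ : ρ.PosSemidef) (hR : R.IsHermitian) (x y : X) :
    (measuredProb ρ R x y : ℂ) = (block ρ x * R * (block ρ y * R)).trace :=
  Complex.ext rfl
    (Complex.nonneg_iff.1 (trace_mul_conj_block_nonneg (block_posSemidef hρ x) hρ hR y)).2

/-- The measurement operators sum to `R ρ_C R = R Q`, which is only the support projection of `ρ_C`.
-/
theorem sum_trace_mul_conj_block (h : IsSqrtPinv (reduced ρ) Q R) (S : Matrix C C ℂ) :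
    ∑ y, (S * R * (block ρ y * R)).trace = (S * (R * Q)).trace := by
  rw [← Matrix.trace_sum, ← Matrix.mul_sum, ← Matrix.sum_mul, ← reduced_eq_sum_block, ← h.conj]
  simp only [Matrix.mul_assoc]

theorem sum_measuredProb (hρ : IsDensity ρ) (h : IsSqrtPinv (reduced ρ) Q R) :
    ∑ x, ∑ y, measuredProb ρ R x y = 1 := by
  apply Complex.ofReal_injective
  push_cast
  simp only [ofReal_measuredProb hρ.posSemidef h.isHermitian_right, sum_trace_mul_conj_block h,
    block_mul_proj hρ.posSemidef h]
  rw [← Matrix.trace_sum, ← reduced_eq_sum_block, trace_reduced, hρ.trace_eq_one]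

/-- The classical state produced by the measurement. -/
def measuredState (ρ : Matrix (X × C) (X × C) ℂ) (R : Matrix C C ℂ) :
    Matrix (X × X) (X × X) ℂ :=
  Matrix.diagonal fun p => (measuredProb ρ R p.1 p.2 : ℂ)

theorem isClassical_measuredState : IsClassical (measuredState ρ R) :=
  Matrix.isDiag_diagonal _

theorem isDensity_measuredState (hρ : IsDensity ρ) (h : IsSqrtPinv (reduced ρ) Q R) :
    IsDensity (measuredState ρ R) where
  posSemidef := Matrix.PosSemidef.diagonal fun p => by
    simpa using measuredProb_nonneg hρ.posSemidef h.isHermitian_right p.1 p.2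
  trace_eq_one := by
    rw [measuredState, Matrix.trace_diagonal, Fintype.sum_prod_type, ← Complex.ofReal_one,
      ← sum_measuredProb hρ h]
    push_cast
    rfl

/-- Measuring the side information does not decrease the min-entropy. -/
theorem minEntropy_le_measuredState [Nonempty X] (hρ : ρ.PosSemidef)
    (h : IsSqrtPinv (reduced ρ) Q R) : minEntropy ρ ≤ minEntropy (measuredState ρ R) := by
  refine sSup_le ?_
  rintro _ ⟨σ, hσ, rfl⟩
  refine sSup_le ?_
  rintro _ ⟨z, hz, rfl⟩
  have hR := h.isHermitian_right
  let q : X → ℝ := fun y => (σ * R * (block ρ y * R)).trace.re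
  have hq : ∀ y, 0 ≤ q y := fun y =>
    (Complex.nonneg_iff.1 (trace_mul_conj_block_nonneg hσ.posSemidef hρ hR y)).1
  have hqsum : ∑ y, q y ≤ 1 := by
    have h1 := trace_mul_nonneg hσ.posSemidef h.posSemidef_one_sub
    rw [Matrix.mul_sub, Matrix.mul_one, Matrix.trace_sub, hσ.trace_eq_one,
      ← sum_trace_mul_conj_block h] at h1
    have := (Complex.nonneg_iff.1 h1).1
    simp only [Complex.sub_re, Complex.one_re, Complex.re_sum] at this
    linarith
  have hbound : ∀ x y, measuredProb ρ R x y ≤ (2 : ℝ) ^ (-z) * q y := fun x y => by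
    have h1 := trace_mul_nonneg (Matrix.le_iff.1 (block_le hz x)) (conj_block_posSemidef hρ hR y)
    rw [Matrix.sub_mul, Matrix.trace_sub, Matrix.smul_mul, Matrix.trace_smul] at h1
    have := (Complex.nonneg_iff.1 h1).1
    rw [Complex.sub_re, Complex.smul_re, smul_eq_mul] at this
    simp only [measuredProb, q]
    simp only [Matrix.mul_assoc] at this ⊢
    linarith
  obtain ⟨y₀⟩ := ‹Nonempty X›
  -- The part of `σ` outside the support of `ρ_C` is never detected; its weight is assigned to an
  -- arbitrary outcome to restore normalization.
  let q' : X → ℝ := fun y => q y + if y = y₀ then 1 - ∑ y, q y else 0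
  have hqq' : ∀ y, q y ≤ q' y := fun y => by
    simp only [q']
    split_ifs <;> linarith
  have hσ' : IsDensity (Matrix.diagonal fun y => (q' y : ℂ)) := by
    refine ⟨Matrix.PosSemidef.diagonal fun y => ?_, ?_⟩
    · simpa using (hq y).trans (hqq' y)
    · rw [Matrix.trace_diagonal, ← Complex.ofReal_sum]
      simp [q', Finset.sum_add_distrib]
  refine le_trans ?_ (le_sSup ⟨_, hσ', rfl⟩)
  refine le_sSup ⟨z, Matrix.le_iff.2 ?_, rfl⟩
  rw [measuredState, ← Matrix.diagonal_one, Matrix.diagonal_kronecker_diagonal,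
    ← Matrix.diagonal_smul, Matrix.diagonal_sub]
  refine Matrix.PosSemidef.diagonal fun p => ?_
  have := (hbound p.1 p.2).trans
    (mul_le_mul_of_nonneg_left (hqq' p.2) (Real.rpow_nonneg zero_le_two (-z)))
  simp only [Pi.zero_apply, Pi.smul_apply, one_mul, Complex.real_smul, ← Complex.ofReal_mul,
    ← Complex.ofReal_sub]
  exact Complex.zero_le_real.2 (sub_nonneg.2 this)

end Measurement

/-! ### The distance from uniform -/

section Centered

variable {Y : Type*} [Fintype Y] [DecidableEq Y]

/-- The centered indicator function of `y`. -/
def centered (y z : Y) : ℝ := (if y = z then 1 else 0) - 1 / Fintype.card Y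

theorem sum_centered (y : Y) : ∑ z, centered y z = 0 := by
  have : (Fintype.card Y : ℝ) ≠ 0 := Nat.cast_ne_zero.2 (Fintype.card_pos_iff.2 ⟨y⟩).ne'
  simp [centered, this]

/-- As a matrix, `centered` is the orthogonal projection onto zero-sum functions, hence symmetric
and idempotent. -/
theorem sum_centered_mul_centered (y y' : Y) :
    ∑ z, centered y z * centered y' z = centered y y' := by
  have h : ∀ z, centered y z * centered y' z =
      (if y' = z then centered y z else 0) - 1 / Fintype.card Y * centered y z := fun z => by
    conv_lhs => enter [2]; rw [centered]
    split_ifs <;> ring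
  simp only [h, Finset.sum_sub_distrib, ← Finset.mul_sum, sum_centered]
  simp

theorem single_sub_maxMixed (y : Y) :
    Matrix.single y y (1 : ℂ) - maxMixed Y = Matrix.diagonal fun z => (centered y z : ℂ) := by
  ext i j
  rcases eq_or_ne i j with rfl | hij
  · simp [maxMixed, centered, Matrix.single_apply, apply_ite Complex.ofReal]
  · simp only [maxMixed, centered, Matrix.single_apply, Matrix.sub_apply, Matrix.smul_apply,
      Matrix.one_apply_ne hij, Matrix.diagonal_apply_ne _ hij]
    rw [if_neg (fun h => hij (h.1.symm.trans h.2))]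
    simp

theorem applyFun_sub_maxMixed {X C : Type*} [Fintype X] (f : X → Y)
    (ρ : Matrix (X × C) (X × C) ℂ) :
    applyFun f ρ - maxMixed Y ⊗ₖ reduced ρ =
      ∑ x, (Matrix.diagonal fun z => (centered (f x) z : ℂ)) ⊗ₖ block ρ x := by
  have : maxMixed Y ⊗ₖ reduced ρ = ∑ x, maxMixed Y ⊗ₖ block ρ x := by
    rw [reduced_eq_sum_block]
    ext i j
    simp [Matrix.sum_apply, Finset.mul_sum]
  rw [this, applyFun, ← Finset.sum_sub_distrib]
  refine Finset.sum_congr rfl fun x _ => ?_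
  rw [← single_sub_maxMixed]
  ext i j
  simp [block, sub_mul]

/-- The positive and negative parts of a zero-sum function each carry half its `ℓ¹` mass. -/
theorem le_half_sum_abs {h : Y → ℝ} (hh : ∑ z, h z = 0) (y : Y) : h y ≤ 1 / 2 * ∑ z, |h z| := by
  have h1 := Finset.add_sum_erase Finset.univ h (Finset.mem_univ y)
  have h2 := Finset.add_sum_erase Finset.univ (fun z => |h z|) (Finset.mem_univ y)
  have h3 := Finset.abs_sum_le_sum_abs h (Finset.univ.erase y)
  have h4 := neg_abs_le (∑ z ∈ Finset.univ.erase y, h z)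
  have h5 := le_abs_self (h y)
  linarith

end Centered

/-! ### Comparing the quantum and measured errors -/

section Product

variable {X₁ X₂ C₁ C₂ Y : Type*} [Fintype X₁] [Fintype X₂] [Fintype C₁] [Fintype C₂] [Fintype Y]
  [DecidableEq X₁] [DecidableEq X₂] [DecidableEq C₁] [DecidableEq C₂] [DecidableEq Y]

/-- The difference between the joint distribution of `f` with the measurement outcomes and the
product of uniform with the distribution of the outcomes. -/
def measuredDefect (f : X₁ × X₂ → Y) (P₁ : X₁ → X₁ → ℝ) (P₂ : X₂ → X₂ → ℝ)
    (p : Y × (X₁ × X₂)) : ℝ :=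
  ∑ x, centered (f x) p.1 * (P₁ x.1 p.2.1 * P₂ x.2 p.2.2)

/-- For each outcome `c` the defect sums to zero over `Y`, so its value at `f c` is at most half its
`ℓ¹` norm. -/
theorem sum_measuredDefect_le (f : X₁ × X₂ → Y) (P₁ : X₁ → X₁ → ℝ) (P₂ : X₂ → X₂ → ℝ) :
    ∑ c, measuredDefect f P₁ P₂ (f c, c) ≤ 1 / 2 * ∑ p, |measuredDefect f P₁ P₂ p| := by
  rw [Fintype.sum_prod_type_right (f := fun p => |measuredDefect f P₁ P₂ p|), Finset.mul_sum]
  refine Finset.sum_le_sum fun c _ => le_half_sum_abs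
    (h := fun z => measuredDefect f P₁ P₂ (z, c)) ?_ (f c)
  simp only [measuredDefect]
  rw [Finset.sum_comm]
  simp [← Finset.sum_mul, sum_centered]

theorem traceNorm_measured (f : X₁ × X₂ → Y) (ρ₁ : Matrix (X₁ × C₁) (X₁ × C₁) ℂ)
    (ρ₂ : Matrix (X₂ × C₂) (X₂ × C₂) ℂ) (R₁ : Matrix C₁ C₁ ℂ) (R₂ : Matrix C₂ C₂ ℂ) :
    traceNorm (applyFun f (productState (measuredState ρ₁ R₁) (measuredState ρ₂ R₂)) -
        maxMixed Y ⊗ₖ reduced (productState (measuredState ρ₁ R₁) (measuredState ρ₂ R₂))) =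
      ∑ p, |measuredDefect f (measuredProb ρ₁ R₁) (measuredProb ρ₂ R₂) p| := by
  rw [applyFun_sub_maxMixed, ← traceNorm_diagonal]
  congr 1
  simp only [block_productState, measuredState, block_diagonal,
    Matrix.diagonal_kronecker_diagonal]
  ext p p'
  rcases eq_or_ne p p' with rfl | h
  · simp [Matrix.sum_apply, measuredDefect]
  · simp [Matrix.sum_apply, h]

theorem traceNorm_sq_le_sum_measuredDefect (f : X₁ × X₂ → Y)
    {ρ₁ : Matrix (X₁ × C₁) (X₁ × C₁) ℂ} {ρ₂ : Matrix (X₂ × C₂) (X₂ × C₂) ℂ}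
    (hρ₁ : IsDensity ρ₁) (hρ₂ : IsDensity ρ₂) {Q₁ R₁ : Matrix C₁ C₁ ℂ} {Q₂ R₂ : Matrix C₂ C₂ ℂ}
    (h₁ : IsSqrtPinv (reduced ρ₁) Q₁ R₁) (h₂ : IsSqrtPinv (reduced ρ₂) Q₂ R₂) :
    traceNorm (applyFun f (productState ρ₁ ρ₂) -
        maxMixed Y ⊗ₖ reduced (productState ρ₁ ρ₂)) ^ 2 ≤
      Fintype.card Y *
        ∑ c, measuredDefect f (measuredProb ρ₁ R₁) (measuredProb ρ₂ R₂) (f c, c) := by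
  rw [applyFun_sub_maxMixed]
  simp only [block_productState]
  set G : Y → Matrix Y Y ℂ := fun y => Matrix.diagonal fun z => (centered y z : ℂ)
  have hG : ∀ y, (G y).IsHermitian := fun y =>
    Matrix.isHermitian_diagonal_of_self_adjoint _ (by ext i; simp)
  have hM : (∑ x : X₁ × X₂, G (f x) ⊗ₖ (block ρ₁ x.1 ⊗ₖ block ρ₂ x.2)).IsHermitian := by
    simp only [Matrix.IsHermitian, Matrix.conjTranspose_sum, Matrix.conjTranspose_kronecker,
      (hG _).eq, (block_posSemidef hρ₁.posSemidef _).isHermitian.eq,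
      (block_posSemidef hρ₂.posSemidef _).isHermitian.eq]
  have hQ : ((1 : Matrix Y Y ℂ) ⊗ₖ (Q₁ ⊗ₖ Q₂)).PosSemidef :=
    Matrix.PosSemidef.one.kronecker (h₁.posSemidef_left.kronecker h₂.posSemidef_left)
  have hR : ((1 : Matrix Y Y ℂ) ⊗ₖ (R₁ ⊗ₖ R₂)).IsHermitian := by
    simp only [Matrix.IsHermitian, Matrix.conjTranspose_kronecker, Matrix.conjTranspose_one,
      h₁.isHermitian_right.eq, h₂.isHermitian_right.eq]
  refine (traceNorm_sq_le hM hQ hR ?_).trans_eq ?_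
  · simp only [Matrix.sum_mul, ← Matrix.mul_kronecker_mul, Matrix.mul_one,
      block_mul_proj hρ₁.posSemidef h₁, block_mul_proj hρ₂.posSemidef h₂]
  · congr 1
    · simp only [← Matrix.mul_kronecker_mul, Matrix.mul_one, Matrix.trace_kronecker, h₁.mul_self,
        h₂.mul_self, trace_reduced, hρ₁.trace_eq_one, hρ₂.trace_eq_one, Matrix.trace_one]
      simp
    · have hGG : ∀ y y', (G y * G y').trace = (centered y y' : ℂ) := fun y y' => by
        simp only [G, Matrix.diagonal_mul_diagonal, Matrix.trace_diagonal, ← Complex.ofReal_mul,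
          ← Complex.ofReal_sum, sum_centered_mul_centered]
      simp only [Matrix.sum_mul, Matrix.mul_sum, ← Matrix.mul_kronecker_mul, Matrix.mul_one,
        Matrix.trace_sum, Matrix.trace_kronecker, hGG,
        ← ofReal_measuredProb hρ₁.posSemidef h₁.isHermitian_right,
        ← ofReal_measuredProb hρ₂.posSemidef h₂.isHermitian_right,
        ← Complex.ofReal_mul, ← Complex.ofReal_sum, Complex.ofReal_re, measuredDefect]

end Product

end

end TwoSource

theorem mainTheorem10 (n₁ n₂ m : ℕ) (k₁ k₂ ε : ℝ)
    (Ext : TwoSource.Bits n₁ → TwoSource.Bits n₂ → TwoSource.Bits m)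
    (hExt : TwoSource.IsWeakExtractorClassical k₁ k₂ ε Ext) :
    TwoSource.IsWeakExtractorQuantum k₁ k₂ (Real.sqrt ((2 : ℝ) ^ ((m : ℝ) - 1) * ε)) Ext := by
  open TwoSource in
  intro C₁ C₂ _ _ _ _ ρ₁ ρ₂ hρ₁ hρ₂ _ _ hk₁ hk₂
  obtain ⟨Q₁, R₁, h₁⟩ := exists_isSqrtPinv (reduced_posSemidef hρ₁.posSemidef)
  obtain ⟨Q₂, R₂, h₂⟩ := exists_isSqrtPinv (reduced_posSemidef hρ₂.posSemidef)
  have hcl := hExt (Bits n₁) (Bits n₂) (measuredState ρ₁ R₁) (measuredState ρ₂ R₂)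
    (isDensity_measuredState hρ₁ h₁) (isDensity_measuredState hρ₂ h₂)
    isClassical_measuredState isClassical_measuredState
    (hk₁.trans (minEntropy_le_measuredState hρ₁.posSemidef h₁))
    (hk₂.trans (minEntropy_le_measuredState hρ₂.posSemidef h₂))
  have hle := sum_measuredDefect_le (fun x : Bits n₁ × Bits n₂ => Ext x.1 x.2)
    (measuredProb ρ₁ R₁) (measuredProb ρ₂ R₂)
  have hsq := traceNorm_sq_le_sum_measuredDefect (fun x : Bits n₁ × Bits n₂ => Ext x.1 x.2)
    hρ₁ hρ₂ h₁ h₂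
  rw [weakError, traceDist, traceNorm_measured] at hcl
  have hcard : (Fintype.card (Bits m) : ℝ) = 2 ^ m := by simp [Bits]
  rw [hcard] at hsq
  have hε : 0 ≤ ε := le_trans (by positivity) hcl
  have hpow : (2 : ℝ) ^ ((m : ℝ) - 1) = 2 ^ m / 2 := by
    rw [Real.rpow_sub two_pos, Real.rpow_natCast, Real.rpow_one]
  have h2m : (0 : ℝ) < 2 ^ m := by positivity
  refine Real.le_sqrt_of_sq_le ?_
  rw [hpow, weakError, traceDist]
  -- The factor `1/2` in the trace distance squares to `1/4`, so the bound obtained is `2^m ε / 4`,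
  -- within the claim because `ε ≥ 0`.
  nlinarith [mul_le_mul_of_nonneg_left (hle.trans hcl) h2m.le, mul_nonneg h2m.le hε]
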